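/- Let $(X_i)_{i\ge 1}$ be a sequence of identically distributed real random variables on a probability space $(\Omega,\mathcal F,\mathbb P)$, with common distribution function $F$. For $n\ge 1$ let $$\alpha(n):=\sup_{k\ge 1}\ \sup\big\{|\mathbb P[A\cap B]-\mathbb P[A]\,\mathbb P[B]| : A\in\sigma(X_1,\dots,X_k),\ B\in\sigma(X_{k+n},X_{k+n+1},\dots)\big\},$$ and suppose that $(X_i)$ is $\alpha$-mixing, i.e. $\alpha(n)\to 0$ as $n\to\infty$. Let $\widehat F_n:=\frac1n\sum_{i=1}^n \mathbf 1_{[X_i,\infty)}$ be the empirical distribution function of $X_1,\dots,X_n$, and for a distribution function $H$ on $\mathbb R$ and $x\in(0,1)$ let $H^{\leftarrow}(x):=\inf\{t\in\mathbb R: H(t)\ge x\}$. Let $r\in[0,\tfrac12)$ and assume that $\alpha(n)\le K n^{-\vartheta}$ for all $n\ge 1$ and some constants $K>0$ and $\vartheta>2r$. Let $y\in(0,1)$, and assume that $F$ is differentiable at $F^{\leftarrow}(y)$ with $F'(F^{\leftarrow}(y))>0$. Then $$n^{r}\,\big|\widehat F_n^{\leftarrow}(y)-F^{\leftarrow}(y)\big|\longrightarrow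 0\qquad \mathbb P\text{-almost surely as } n\to\infty.$$ -/

import Mathlib

open MeasureTheory ProbabilityTheory Filter
open scoped Topology

noncomputable section

namespace QuantileMixing

/-- The sigma-algebra generated by the variables `X i` with `i ≤ k`.
Sequences are indexed from `0`: the entry `X i` is the `(i + 1)`-st variable of the sequence. -/
abbrev pastSigma {Ω : Type*} (X : ℕ → Ω → ℝ) (k : ℕ) : MeasurableSpace Ω :=
  ⨆ i ∈ Set.Iic k, MeasurableSpace.comap (X i) inferInstance

/-- The sigma-algebra generated by the variables `X i` with `i ≥ m`. -/
abbrev futureSigma {Ω : Type*} (X : ℕ → Ω → ℝ) (m : ℕ) : MeasurableSpace Ω :=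
  ⨆ i ∈ Set.Ici m, MeasurableSpace.comap (X i) inferInstance

/-- The numbers `|P(A ∩ B) - P(A) P(B)|`, where `A` is an event of the past up to some time `k`
and `B` is an event of the future from time `k + n` on. -/
def mixingSet {Ω : Type*} [MeasurableSpace Ω] (μ : Measure Ω) (X : ℕ → Ω → ℝ) (n : ℕ) : Set ℝ :=
  {a | ∃ (k : ℕ) (A B : Set Ω), MeasurableSet[pastSigma X k] A ∧
    MeasurableSet[futureSigma X (k + n)] B ∧ a = |μ.real (A ∩ B) - μ.real A * μ.real B|}

/-- Rosenblatt's (strong) mixing coefficient `α(n)` of the sequence `X` under `μ`. -/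
def alphaCoeff {Ω : Type*} [MeasurableSpace Ω] (μ : Measure Ω) (X : ℕ → Ω → ℝ) (n : ℕ) : ℝ :=
  sSup (mixingSet μ X n)

/-- The sequence `X` is α-mixing under `μ`: its mixing coefficients tend to zero. -/
def IsAlphaMixing {Ω : Type*} [MeasurableSpace Ω] (μ : Measure Ω) (X : ℕ → Ω → ℝ) : Prop :=
  Tendsto (alphaCoeff μ X) atTop (𝓝 0)

/-- For a probability measure the supremum defining `α(n)` is a least upper bound. -/
theorem isLUB_alphaCoeff {Ω : Type*} [MeasurableSpace Ω] (μ : Measure Ω) [IsProbabilityMeasure μ]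
    (X : ℕ → Ω → ℝ) (n : ℕ) : IsLUB (mixingSet μ X n) (alphaCoeff μ X n) := by
  refine isLUB_csSup ⟨_, 0, ∅, ∅, @MeasurableSet.empty _ (pastSigma X 0),
    @MeasurableSet.empty _ (futureSigma X (0 + n)), rfl⟩ ⟨1, ?_⟩
  rintro _ ⟨k, A, B, -, -, rfl⟩
  have h1 : μ.real (A ∩ B) ≤ 1 := measureReal_le_one
  have h2 : μ.real A ≤ 1 := measureReal_le_one
  have h3 : μ.real B ≤ 1 := measureReal_le_one
  have h4 : 0 ≤ μ.real (A ∩ B) := measureReal_nonneg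
  have h5 : 0 ≤ μ.real A := measureReal_nonneg
  have h6 : 0 ≤ μ.real B := measureReal_nonneg
  rw [abs_le]
  constructor <;> nlinarith [mul_nonneg h5 h6, mul_le_one₀ h2 h6 h3]

/-- The empirical distribution function of the first `n` variables of the sequence `X`,
at the outcome `ω`: the proportion of those variables whose value is at most `t`. -/
def empiricalCDF {Ω : Type*} (X : ℕ → Ω → ℝ) (n : ℕ) (ω : Ω) (t : ℝ) : ℝ :=
  (1 / (n : ℝ)) * ∑ i ∈ Finset.range n, (Set.Ici (X i ω)).indicator (fun _ => (1 : ℝ)) t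

/-- The left-continuous inverse `H^←(x) = inf {t : H t ≥ x}` of a nondecreasing function `H`.
It is used for a distribution function `H` and a level `x` in `(0,1)` only, where the set is
nonempty and bounded below, see the two facts after this definition. -/
def leftInv (H : ℝ → ℝ) (x : ℝ) : ℝ :=
  sInf {t : ℝ | x ≤ H t}

theorem isGLB_leftInv_cdf (ν : Measure ℝ) [IsProbabilityMeasure ν] {y : ℝ} (hy : y ∈ Set.Ioo 0 1) :
    IsGLB {t : ℝ | y ≤ cdf ν t} (leftInv (cdf ν) y) := by
  obtain ⟨a, ha⟩ := ((tendsto_cdf_atTop ν).eventually (eventually_ge_nhds hy.2)).exists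
  obtain ⟨b, hb⟩ := ((tendsto_cdf_atBot ν).eventually (eventually_lt_nhds hy.1)).exists
  refine isGLB_csInf ⟨a, ha⟩ ⟨b, fun t ht => ?_⟩
  by_contra h
  exact absurd (lt_of_le_of_lt (le_trans ht ((monotone_cdf ν) (not_le.mp h).le)) hb)
    (lt_irrefl _)

theorem isGLB_leftInv_empiricalCDF {Ω : Type*} (X : ℕ → Ω → ℝ) {n : ℕ} (hn : 1 ≤ n) (ω : Ω)
    {y : ℝ} (hy : y ∈ Set.Ioo 0 1) :
    IsGLB {t : ℝ | y ≤ empiricalCDF X n ω t} (leftInv (empiricalCDF X n ω) y) := by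
  have hn' : (n : ℝ) ≠ 0 := by positivity
  obtain ⟨M, hM⟩ := ((Finset.range n).image (fun i => X i ω)).bddAbove
  obtain ⟨m, hm⟩ := ((Finset.range n).image (fun i => X i ω)).bddBelow
  refine isGLB_csInf ⟨M, ?_⟩ ⟨m, fun t ht => ?_⟩
  · have h : ∀ i ∈ Finset.range n, (Set.Ici (X i ω)).indicator (fun _ => (1 : ℝ)) M = 1 := by
      intro i hi
      exact Set.indicator_of_mem (hM (by simpa using ⟨i, by simpa using hi, rfl⟩)) _
    simp only [Set.mem_ofPred_eq, empiricalCDF]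
    rw [Finset.sum_congr rfl h]
    simpa [hn'] using hy.2.le
  · by_contra hlt
    have h : ∀ i ∈ Finset.range n, (Set.Ici (X i ω)).indicator (fun _ => (1 : ℝ)) t = 0 := by
      intro i hi
      refine Set.indicator_of_notMem (fun hmem => hlt (le_trans (hm ?_) hmem)) _
      simpa using ⟨i, by simpa using hi, rfl⟩
    simp only [Set.mem_ofPred_eq, empiricalCDF] at ht
    rw [Finset.sum_congr rfl h] at ht
    simp only [Finset.sum_const_zero, mul_zero] at ht
    exact absurd hy.1 (not_lt.mpr ht)

end QuantileMixing

end

/-!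
Write `x` for the `y`-quantile of `F`. Since `F` is continuous at `x`, `F x = y`, and since
`F' x > 0` there is `c > 0` with `F (x - δ) ≤ y - c δ` and `y + c δ ≤ F (x + δ)` for all small
`δ > 0`. So the empirical quantile lies within `δ` of `x` as soon as the empirical distribution
function is within `c δ` of `F` at the two points `x ± δ`
(`exists_linear_growth`, `abs_leftInv_empiricalCDF_sub_le`).

Take `τ` with `2 r < τ < min ϑ 1`. Covariances of the centred indicators of `{X i ≤ t}` are bounded
by the mixing coefficients, so a block of `n` of them has a sum with second moment `O(n ^ (2 - τ))`
(`integral_sq_sum_centredIndicator_le`, `sum_range_alphaCoeff_le`). A maximal inequality of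
Rademacher–Menshov type (`measureReal_exists_le_abs_sum_le`) extends this, at the price of a factor
`(L + 1) ^ 2`, to the maximum over all partial sums of length at most `2 ^ L`. The probability that
one of them exceeds a constant times `2 ^ L * 2 ^ (-r L)` is thus
`O((L + 1) ^ 2 * 2 ^ ((2 r - τ) L))`, which is summable, and the Borel–Cantelli lemma applies
(`ae_eventually_abs_sum_centredIndicator_lt`). The maximum is what reaches every `n` of the dyadic
block `2 ^ l ≤ n < 2 ^ (l + 1)`, because `n ^ (-r)` varies by a bounded factor there and one radius
`δ = ε * 2 ^ (-r (l + 1)) ≤ ε * n ^ (-r)` serves the whole block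
(`ae_eventually_rpow_mul_le`).
-/

namespace QuantileMixing

/-! ### A dyadic maximal inequality -/

/-- The sum of the squares of the sums of `z` over dyadic blocks of `[a, a + 2 ^ L)`. Besides the
single entries, only left halves enter: the right half of a block is not needed as a whole, since
an initial segment that reaches into it splits into the left half and an initial segment of the
right half. -/
def dyadicSq (z : ℕ → ℝ) : ℕ → ℕ → ℝ
  | 0, a => z a ^ 2
  | L + 1, a => (∑ i ∈ Finset.Ico a (a + 2 ^ L), z i) ^ 2 + dyadicSq z L a
      + dyadicSq z L (a + 2 ^ L)

theorem dyadicSq_nonneg (z : ℕ → ℝ) (L a : ℕ) : 0 ≤ dyadicSq z L a := by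
  induction L generalizing a with
  | zero => exact sq_nonneg _
  | succ L ih => exact add_nonneg (add_nonneg (sq_nonneg _) (ih _)) (ih _)

/-- Every initial segment of a dyadic interval of length `2 ^ L` is a disjoint union of at most
`L + 1` of the blocks in `dyadicSq`, hence this Cauchy–Schwarz bound, uniform in `m`. -/
theorem sq_sum_Ico_le_dyadicSq (z : ℕ → ℝ) (L a m : ℕ) (hm : m ≤ 2 ^ L) :
    (∑ i ∈ Finset.Ico a (a + m), z i) ^ 2 ≤ (L + 1) * dyadicSq z L a := by
  induction L generalizing a m with
  | zero =>
    have hm' : m = 0 ∨ m = 1 := by simp at hm; omega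
    rcases hm' with rfl | rfl
    · simpa using mul_nonneg zero_le_one (dyadicSq_nonneg z 0 a)
    · simp [dyadicSq]
  | succ L ih =>
    have h1 := dyadicSq_nonneg z L a
    have h2 := dyadicSq_nonneg z L (a + 2 ^ L)
    simp only [dyadicSq, Nat.cast_add, Nat.cast_one]
    have hL : (0 : ℝ) ≤ L := Nat.cast_nonneg L
    rcases le_total m (2 ^ L) with h | h
    · nlinarith [ih a m h, sq_nonneg (∑ i ∈ Finset.Ico a (a + 2 ^ L), z i)]
    · obtain ⟨k, rfl⟩ := Nat.exists_eq_add_of_le h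
      have hk : k ≤ 2 ^ L := by rw [pow_succ] at hm; omega
      rw [← Finset.sum_Ico_consecutive z (Nat.le_add_right a (2 ^ L))
        (by omega : a + 2 ^ L ≤ a + (2 ^ L + k)), ← add_assoc]
      have h3 := ih (a + 2 ^ L) k hk
      set s := ∑ i ∈ Finset.Ico a (a + 2 ^ L), z i
      set u := ∑ i ∈ Finset.Ico (a + 2 ^ L) (a + 2 ^ L + k), z i
      have hL1 : (0 : ℝ) < L + 1 := by positivity
      -- `2 s u ≤ (L + 1) s² + u² / (L + 1)`, and `u² / (L + 1)` is bounded by the induction hypothesis.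
      have h4 : 2 * s * u ≤ (L + 1) * s ^ 2 + dyadicSq z L (a + 2 ^ L) := by
        have : (L + 1) * (2 * s * u) ≤ (L + 1) * ((L + 1) * s ^ 2 + dyadicSq z L (a + 2 ^ L)) := by
          nlinarith [sq_nonneg ((L + 1) * s - u)]
        exact le_of_mul_le_mul_left this hL1
      nlinarith [mul_nonneg hL h1]

section Maximal

variable {Ω : Type*} [MeasurableSpace Ω] {μ : Measure Ω}

theorem integrable_dyadicSq {Y : ℕ → Ω → ℝ} (hY : ∀ i, MemLp (Y i) 2 μ) (L a : ℕ) :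
    Integrable (fun ω => dyadicSq (fun i => Y i ω) L a) μ := by
  induction L generalizing a with
  | zero => exact (hY a).integrable_sq
  | succ L ih =>
    exact ((memLp_finsetSum _ fun i _ => hY i).integrable_sq.add (ih a)).add (ih _)

/-- Under a bound `C q ^ L` on the second moments of block sums, with `2 ≤ q`, each of the `L + 1`
dyadic levels contributes at most `C q ^ L` to the mean of `dyadicSq`. -/
theorem integral_dyadicSq_le {Y : ℕ → Ω → ℝ} (hY : ∀ i, MemLp (Y i) 2 μ) {C q : ℝ} (hC : 0 ≤ C)
    (hq : 2 ≤ q)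
    (hvar : ∀ L a, ∫ ω, (∑ i ∈ Finset.Ico a (a + 2 ^ L), Y i ω) ^ 2 ∂μ ≤ C * q ^ L) (L a : ℕ) :
    ∫ ω, dyadicSq (fun i => Y i ω) L a ∂μ ≤ C * (L + 1) * q ^ L := by
  induction L generalizing a with
  | zero => simpa [dyadicSq] using hvar 0 a
  | succ L ih =>
    have hS : Integrable (fun ω => (∑ i ∈ Finset.Ico a (a + 2 ^ L), Y i ω) ^ 2) μ :=
      (memLp_finsetSum _ fun i _ => hY i).integrable_sq
    have hI := integrable_dyadicSq hY L
    have hSI : Integrable (fun ω => (∑ i ∈ Finset.Ico a (a + 2 ^ L), Y i ω) ^ 2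
        + dyadicSq (fun i => Y i ω) L a) μ := hS.add (hI a)
    simp only [dyadicSq]
    rw [integral_add hSI (hI _), integral_add hS (hI a)]
    have hCq : 0 ≤ C * q ^ L := by positivity
    have hL : (0 : ℝ) ≤ L := Nat.cast_nonneg L
    calc _ ≤ C * q ^ L + C * (L + 1) * q ^ L + C * (L + 1) * q ^ L :=
          add_le_add (add_le_add (hvar L a) (ih a)) (ih _)
      _ ≤ (L + 2) * (C * q ^ L) * 2 := by nlinarith
      _ ≤ (L + 2) * (C * q ^ L) * q := by gcongr
      _ = _ := by push_cast; ring

/-- A maximal inequality of Rademacher–Menshov type: a second moment bound for block sums bounds the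
tail of the maximal partial sum, up to a factor that is quadratic in the logarithm of the length. -/
theorem measureReal_exists_le_abs_sum_le [IsFiniteMeasure μ] {Y : ℕ → Ω → ℝ}
    (hY : ∀ i, MemLp (Y i) 2 μ) {C q : ℝ} (hC : 0 ≤ C) (hq : 2 ≤ q)
    (hvar : ∀ L a, ∫ ω, (∑ i ∈ Finset.Ico a (a + 2 ^ L), Y i ω) ^ 2 ∂μ ≤ C * q ^ L)
    (L : ℕ) {b : ℝ} (hb : 0 < b) :
    μ.real {ω | ∃ m ≤ 2 ^ L, b ≤ |∑ i ∈ Finset.range m, Y i ω|} ≤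
      C * (L + 1) ^ 2 * q ^ L / b ^ 2 := by
  have hsub : {ω | ∃ m ≤ 2 ^ L, b ≤ |∑ i ∈ Finset.range m, Y i ω|} ⊆
      {ω | b ^ 2 / (L + 1) ≤ dyadicSq (fun i => Y i ω) L 0} := by
    rintro ω ⟨m, hm, hbm⟩
    have h := sq_sum_Ico_le_dyadicSq (fun i => Y i ω) L 0 m hm
    rw [zero_add, ← Finset.range_eq_Ico] at h
    have h' : b ^ 2 ≤ (∑ i ∈ Finset.range m, Y i ω) ^ 2 := by
      rw [← sq_abs (∑ i ∈ Finset.range m, Y i ω)]; gcongr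
    exact (div_le_iff₀' (by positivity)).2 (h'.trans h)
  refine (measureReal_mono hsub).trans ?_
  have hmk := mul_meas_ge_le_integral_of_nonneg
    (Eventually.of_forall fun ω => dyadicSq_nonneg (fun i => Y i ω) L 0)
    (integrable_dyadicSq hY L 0) (b ^ 2 / (L + 1))
  have h2 := hmk.trans (integral_dyadicSq_le hY hC hq hvar L 0)
  rw [le_div_iff₀ (by positivity)]
  rw [div_mul_eq_mul_div, div_le_iff₀ (by positivity)] at h2
  linarith

end Maximal

/-! ### Second moments under strong mixing -/

theorem sum_rpow_neg_le {τ : ℝ} (h0 : 0 ≤ τ) (h1 : τ < 1) (n : ℕ) :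
    ∑ k ∈ Finset.range n, ((k + 1 : ℕ) : ℝ) ^ (-τ) ≤ (n : ℝ) ^ (1 - τ) / (1 - τ) := by
  have h1' : 0 < 1 - τ := by linarith
  induction n with
  | zero => simp; positivity
  | succ n ih =>
    rw [Finset.sum_range_succ]
    have hn : (0 : ℝ) < (n + 1 : ℕ) := by positivity
    -- Bernoulli's inequality for `n = (n + 1) (1 - 1 / (n + 1))` and the exponent `1 - τ`.
    have hB : (1 + (-1 / ((n + 1 : ℕ) : ℝ))) ^ (1 - τ) ≤
        1 + (1 - τ) * (-1 / ((n + 1 : ℕ) : ℝ)) := by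
      refine rpow_one_add_le_one_add_mul_self ?_ h1'.le (by linarith)
      rw [le_div_iff₀ hn]; push_cast; linarith [(Nat.cast_nonneg n : (0 : ℝ) ≤ n)]
    have heq : (n : ℝ) = ((n + 1 : ℕ) : ℝ) * (1 + (-1 / ((n + 1 : ℕ) : ℝ))) := by
      field_simp; push_cast; ring
    have hnn : 0 ≤ 1 + (-1 / ((n + 1 : ℕ) : ℝ)) := by
      have : (0 : ℝ) ≤ ((n + 1 : ℕ) : ℝ) * (1 + (-1 / ((n + 1 : ℕ) : ℝ))) := heq ▸ Nat.cast_nonneg n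
      exact nonneg_of_mul_nonneg_right this hn
    have key : (n : ℝ) ^ (1 - τ) ≤ ((n + 1 : ℕ) : ℝ) ^ (1 - τ)
        - (1 - τ) * ((n + 1 : ℕ) : ℝ) ^ (-τ) := by
      have e : ((n + 1 : ℕ) : ℝ) ^ (1 - τ) = ((n + 1 : ℕ) : ℝ) ^ (-τ) * ((n + 1 : ℕ) : ℝ) := by
        rw [← Real.rpow_add_one hn.ne']; ring_nf
      calc (n : ℝ) ^ (1 - τ) = ((n + 1 : ℕ) : ℝ) ^ (1 - τ) *
            (1 + (-1 / ((n + 1 : ℕ) : ℝ))) ^ (1 - τ) := by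
            rw [← Real.mul_rpow hn.le hnn, ← heq]
        _ ≤ ((n + 1 : ℕ) : ℝ) ^ (1 - τ) * (1 + (1 - τ) * (-1 / ((n + 1 : ℕ) : ℝ))) := by gcongr
        _ = _ := by rw [e]; field_simp; ring
    rw [le_div_iff₀ h1'] at ih ⊢
    nlinarith

/-- In each row of the double sum, every distance occurs at most once to the left and at most once to
the right of the diagonal. -/
theorem sum_sum_dist_le {f : ℕ → ℝ} (hf : ∀ k, 0 ≤ f k) (a n : ℕ) :
    ∑ i ∈ Finset.Ico a (a + n), ∑ j ∈ Finset.Ico a (a + n), f (Nat.dist i j) ≤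
      2 * n * ∑ k ∈ Finset.range n, f k := by
  have h : ∀ i ∈ Finset.Ico a (a + n), ∑ j ∈ Finset.Ico a (a + n), f (Nat.dist i j) ≤
      2 * ∑ k ∈ Finset.range n, f k := by
    intro i hi
    rw [Finset.mem_Ico] at hi
    rw [← Finset.sum_Ico_consecutive _ hi.1 hi.2.le, two_mul]
    refine add_le_add ?_ ?_
    · rw [← Finset.sum_image (s := Finset.Ico a i) (g := fun j => Nat.dist i j) (f := f)
        (fun x hx y hy hxy => by
          simp only [Finset.coe_Ico, Set.mem_Ico, Nat.dist] at hx hy hxy; omega)]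
      refine Finset.sum_le_sum_of_subset_of_nonneg (fun k hk => ?_) fun k _ _ => hf k
      simp only [Finset.mem_image, Finset.mem_Ico, Nat.dist, Finset.mem_range] at hk ⊢
      omega
    · rw [← Finset.sum_image (s := Finset.Ico i (a + n)) (g := fun j => Nat.dist i j) (f := f)
        (fun x hx y hy hxy => by
          simp only [Finset.coe_Ico, Set.mem_Ico, Nat.dist] at hx hy hxy; omega)]
      refine Finset.sum_le_sum_of_subset_of_nonneg (fun k hk => ?_) fun k _ _ => hf k
      simp only [Finset.mem_image, Finset.mem_Ico, Nat.dist, Finset.mem_range] at hk ⊢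
      omega
  refine (Finset.sum_le_sum h).trans (le_of_eq ?_)
  simp; ring

section Mixing

variable {Ω : Type*} [MeasurableSpace Ω] {μ : Measure Ω} [IsProbabilityMeasure μ]
  {X : ℕ → Ω → ℝ}

/-- The indicator of the event `{X i ≤ t}` minus the probability of that event. -/
noncomputable def centredIndicator (μ : Measure Ω) (X : ℕ → Ω → ℝ) (t : ℝ) (i : ℕ) (ω : Ω) : ℝ :=
  (X i ⁻¹' Set.Iic t).indicator (fun _ => (1 : ℝ)) ω - μ.real (X i ⁻¹' Set.Iic t)

theorem memLp_centredIndicator (hX : ∀ i, Measurable (X i)) (t : ℝ) (i : ℕ) :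
    MemLp (centredIndicator μ X t i) 2 μ :=
  (memLp_indicator_const 2 (hX i measurableSet_Iic) 1 (Or.inr (measure_ne_top _ _))).sub
    (memLp_const _)

theorem integral_centredIndicator_mul (hX : ∀ i, Measurable (X i)) (t : ℝ) (i j : ℕ) :
    ∫ ω, centredIndicator μ X t i ω * centredIndicator μ X t j ω ∂μ =
      μ.real (X i ⁻¹' Set.Iic t ∩ X j ⁻¹' Set.Iic t)
        - μ.real (X i ⁻¹' Set.Iic t) * μ.real (X j ⁻¹' Set.Iic t) := by
  have hA : MeasurableSet (X i ⁻¹' Set.Iic t) := hX i measurableSet_Iic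
  have hB : MeasurableSet (X j ⁻¹' Set.Iic t) := hX j measurableSet_Iic
  simp only [centredIndicator]
  set A := X i ⁻¹' Set.Iic t
  set B := X j ⁻¹' Set.Iic t
  have hind : ∀ {S : Set Ω}, MeasurableSet S → Integrable (S.indicator fun _ => (1 : ℝ)) μ :=
    fun hS => (integrable_const _).indicator hS
  have hint : ∀ {S : Set Ω}, MeasurableSet S →
      ∫ ω, S.indicator (fun _ => (1 : ℝ)) ω ∂μ = μ.real S := fun hS => by
    rw [integral_indicator_const _ hS]; simp
  have e : ∀ ω, (A.indicator (fun _ => (1 : ℝ)) ω - μ.real A) *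
      (B.indicator (fun _ => (1 : ℝ)) ω - μ.real B) =
      (A ∩ B).indicator (fun _ => (1 : ℝ)) ω - μ.real B * A.indicator (fun _ => (1 : ℝ)) ω
        - μ.real A * B.indicator (fun _ => (1 : ℝ)) ω + μ.real A * μ.real B := by
    intro ω
    by_cases h1 : ω ∈ A <;> by_cases h2 : ω ∈ B <;> simp [h1, h2] <;> ring
  simp only [e]
  have i1 := hind (hA.inter hB)
  have i2 := (hind hA).const_mul (μ.real B)
  have i3 := (hind hB).const_mul (μ.real A)
  have i12 : Integrable (fun ω => (A ∩ B).indicator (fun _ => (1 : ℝ)) ω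
      - μ.real B * A.indicator (fun _ => (1 : ℝ)) ω) μ := i1.sub i2
  have i123 : Integrable (fun ω => (A ∩ B).indicator (fun _ => (1 : ℝ)) ω
      - μ.real B * A.indicator (fun _ => (1 : ℝ)) ω
      - μ.real A * B.indicator (fun _ => (1 : ℝ)) ω) μ := i12.sub i3
  rw [integral_add i123 (integrable_const _), integral_sub i12 i3,
    integral_sub i1 i2, integral_const_mul, integral_const_mul, hint hA, hint hB,
    hint (hA.inter hB)]
  simp; ring

theorem alphaCoeff_nonneg (n : ℕ) : 0 ≤ alphaCoeff μ X n := by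
  refine (abs_nonneg _).trans ((isLUB_alphaCoeff μ X n).1 ⟨0, ∅, ∅,
    @MeasurableSet.empty _ (pastSigma X 0), @MeasurableSet.empty _ (futureSigma X (0 + n)), rfl⟩)

theorem abs_integral_centredIndicator_mul_le (hX : ∀ i, Measurable (X i)) (t : ℝ) (i j : ℕ) :
    |∫ ω, centredIndicator μ X t i ω * centredIndicator μ X t j ω ∂μ| ≤
      alphaCoeff μ X (Nat.dist i j) := by
  wlog h : i ≤ j generalizing i j
  · simpa only [mul_comm, Nat.dist_comm] using this j i (le_of_not_ge h)
  rw [integral_centredIndicator_mul hX]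
  refine (isLUB_alphaCoeff μ X _).1 ⟨i, X i ⁻¹' Set.Iic t, X j ⁻¹' Set.Iic t, ?_, ?_, rfl⟩
  · exact (le_iSup₂ (f := fun l (_ : l ∈ Set.Iic i) => MeasurableSpace.comap (X l) inferInstance)
      i (Set.mem_Iic.2 le_rfl)) _ ⟨_, measurableSet_Iic, rfl⟩
  · exact (le_iSup₂ (f := fun l (_ : l ∈ Set.Ici _) => MeasurableSpace.comap (X l) inferInstance)
      j (by simp only [Set.mem_Ici, Nat.dist]; omega)) _ ⟨_, measurableSet_Iic, rfl⟩

theorem integral_sq_sum_centredIndicator_le (hX : ∀ i, Measurable (X i)) (t : ℝ) (a n : ℕ) :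
    ∫ ω, (∑ i ∈ Finset.Ico a (a + n), centredIndicator μ X t i ω) ^ 2 ∂μ ≤
      2 * n * ∑ k ∈ Finset.range n, alphaCoeff μ X k := by
  have hint : ∀ i j, Integrable
      (fun ω => centredIndicator μ X t i ω * centredIndicator μ X t j ω) μ := fun i j =>
    (memLp_centredIndicator hX t i).integrable_mul (memLp_centredIndicator hX t j)
  simp only [sq, Finset.sum_mul_sum]
  rw [integral_finsetSum _ fun i _ => integrable_finsetSum _ fun j _ => hint i j]
  simp only [integral_finsetSum _ fun j _ => hint _ j]
  refine le_trans ?_ (sum_sum_dist_le (fun k => alphaCoeff_nonneg (μ := μ) (X := X) k) a n)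
  exact Finset.sum_le_sum fun i _ => Finset.sum_le_sum fun j _ =>
    (le_abs_self _).trans (abs_integral_centredIndicator_mul_le hX t i j)

theorem alphaCoeff_le_one (n : ℕ) : alphaCoeff μ X n ≤ 1 := by
  refine (isLUB_alphaCoeff μ X n).2 ?_
  rintro _ ⟨k, A, B, -, -, rfl⟩
  have h1 : μ.real (A ∩ B) ≤ 1 := measureReal_le_one
  have h2 : μ.real A ≤ 1 := measureReal_le_one
  have h3 : μ.real B ≤ 1 := measureReal_le_one
  have h4 : 0 ≤ μ.real (A ∩ B) := measureReal_nonneg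
  have h5 : 0 ≤ μ.real A := measureReal_nonneg
  have h6 : 0 ≤ μ.real B := measureReal_nonneg
  rw [abs_le]
  constructor <;> nlinarith [mul_nonneg h5 h6, mul_le_one₀ h2 h6 h3]

/-- The rate is only assumed for `n ≥ 1`; the coefficient at `0` is bounded by `1`. -/
theorem sum_range_alphaCoeff_le {K τ : ℝ} (hK : 0 ≤ K) (h0 : 0 ≤ τ) (h1 : τ < 1)
    (hrate : ∀ n : ℕ, 1 ≤ n → alphaCoeff μ X n ≤ K * (n : ℝ) ^ (-τ)) {n : ℕ} (hn : 1 ≤ n) :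
    ∑ k ∈ Finset.range n, alphaCoeff μ X k ≤ (1 + K / (1 - τ)) * (n : ℝ) ^ (1 - τ) := by
  obtain ⟨m, rfl⟩ := Nat.exists_eq_add_of_le' hn
  have h1' : 0 < 1 - τ := by linarith
  rw [Finset.sum_range_succ', add_comm]
  have hp : (1 : ℝ) ≤ ((m + 1 : ℕ) : ℝ) ^ (1 - τ) :=
    Real.one_le_rpow (by exact_mod_cast hn) h1'.le
  calc _ ≤ 1 + ∑ k ∈ Finset.range m, K * ((k + 1 : ℕ) : ℝ) ^ (-τ) :=
        add_le_add (alphaCoeff_le_one 0) (Finset.sum_le_sum fun k _ => hrate _ (by omega))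
    _ ≤ 1 + K * ((m : ℝ) ^ (1 - τ) / (1 - τ)) := by
        rw [← Finset.mul_sum]; gcongr; exact sum_rpow_neg_le h0 h1 m
    _ ≤ ((m + 1 : ℕ) : ℝ) ^ (1 - τ) + K * (((m + 1 : ℕ) : ℝ) ^ (1 - τ) / (1 - τ)) := by
        gcongr; omega
    _ = _ := by ring

theorem measureReal_exists_le_abs_sum_centredIndicator_le (hX : ∀ i, Measurable (X i))
    {K τ : ℝ} (hK : 0 ≤ K) (h0 : 0 ≤ τ) (h1 : τ < 1)
    (hrate : ∀ n : ℕ, 1 ≤ n → alphaCoeff μ X n ≤ K * (n : ℝ) ^ (-τ)) (t : ℝ) (L : ℕ) {b : ℝ}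
    (hb : 0 < b) :
    μ.real {ω | ∃ m ≤ 2 ^ L, b ≤ |∑ i ∈ Finset.range m, centredIndicator μ X t i ω|} ≤
      2 * (1 + K / (1 - τ)) * (L + 1) ^ 2 * ((2 : ℝ) ^ (2 - τ)) ^ L / b ^ 2 := by
  have h1' : 0 < 1 - τ := by linarith
  refine measureReal_exists_le_abs_sum_le (memLp_centredIndicator hX t) (by positivity) ?_ ?_ L hb
  · simpa using Real.rpow_le_rpow_of_exponent_le one_le_two (by linarith : (1 : ℝ) ≤ 2 - τ)
  · intro L a
    refine (integral_sq_sum_centredIndicator_le hX t a _).trans ?_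
    have h := sum_range_alphaCoeff_le hK h0 h1 hrate (Nat.one_le_two_pow (n := L))
    refine (mul_le_mul_of_nonneg_left h (by positivity)).trans (le_of_eq ?_)
    have e : ((2 : ℝ) ^ (2 - τ)) ^ L = ((2 ^ L : ℕ) : ℝ) * ((2 ^ L : ℕ) : ℝ) ^ (1 - τ) := by
      push_cast
      rw [← Real.rpow_one_add' (by positivity) (by linarith), ← Real.rpow_natCast,
        ← Real.rpow_natCast, ← Real.rpow_mul zero_le_two, ← Real.rpow_mul zero_le_two]
      ring_nf
    rw [e]; ring

end Mixing

/-! ### Borel–Cantelli along dyadic blocks -/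

theorem summable_succ_sq_mul_pow {ρ : ℝ} (h0 : 0 < ρ) (h1 : ρ < 1) :
    Summable fun L : ℕ => ((L : ℝ) + 1) ^ 2 * ρ ^ L := by
  have hρ : ‖ρ‖ < 1 := by rwa [Real.norm_of_nonneg h0.le]
  have h : Summable fun L : ℕ => ((L + 1 : ℕ) : ℝ) ^ 2 * ρ ^ (L + 1) :=
    (summable_nat_add_iff (f := fun n : ℕ => (n : ℝ) ^ 2 * ρ ^ n) 1).2
      (summable_pow_mul_geometric_of_norm_lt_one 2 hρ)
  refine (h.mul_left ρ⁻¹).congr fun L => ?_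
  push_cast
  rw [pow_succ ρ L]
  field_simp

section Mixing

variable {Ω : Type*} [MeasurableSpace Ω] {μ : Measure Ω} [IsProbabilityMeasure μ]
  {X : ℕ → Ω → ℝ}

/-- The level `t L` may change with the dyadic scale: it is fixed within each maximal inequality. The
threshold is `b * 2 ^ ((1 - r) L)`, the size of `2 ^ L` deviations of order `2 ^ (-r L)`. -/
theorem ae_eventually_abs_sum_centredIndicator_lt (hX : ∀ i, Measurable (X i))
    {K τ r : ℝ} (hK : 0 ≤ K) (h0 : 0 ≤ τ) (h1 : τ < 1) (hr : 2 * r < τ)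
    (hrate : ∀ n : ℕ, 1 ≤ n → alphaCoeff μ X n ≤ K * (n : ℝ) ^ (-τ)) (t : ℕ → ℝ) {b : ℝ}
    (hb : 0 < b) :
    ∀ᵐ ω ∂μ, ∀ᶠ L in atTop, ∀ m ≤ 2 ^ L,
      |∑ i ∈ Finset.range m, centredIndicator μ X (t L) i ω| < b * (2 * (2 : ℝ) ^ (-r)) ^ L := by
  have hs : (0 : ℝ) < 2 ^ (-r) := by positivity
  set w : ℝ := 2 * (2 : ℝ) ^ (-r)
  have hw : 0 < w := by positivity
  have hww : w ^ 2 = (2 : ℝ) ^ (2 - 2 * r) := by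
    simp only [w]
    rw [mul_pow, ← Real.rpow_natCast ((2 : ℝ) ^ (-r)) 2, ← Real.rpow_mul zero_le_two,
      ← Real.rpow_natCast 2 2, ← Real.rpow_add zero_lt_two]
    push_cast; ring_nf
  -- The ratio of the geometric series is `2 ^ (2 r - τ)`.
  have hρ : (2 : ℝ) ^ (2 - τ) / w ^ 2 < 1 := by
    rw [div_lt_one (by positivity), hww]
    exact Real.rpow_lt_rpow_of_exponent_lt one_lt_two (by linarith)
  set bad : ℕ → Set Ω := fun L => {ω | ∃ m ≤ 2 ^ L,
    b * w ^ L ≤ |∑ i ∈ Finset.range m, centredIndicator μ X (t L) i ω|}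
  have hsum : Summable fun L => μ.real (bad L) := by
    refine Summable.of_nonneg_of_le (fun _ => measureReal_nonneg) (fun L => ?_)
      ((summable_succ_sq_mul_pow (by positivity) hρ).mul_left (2 * (1 + K / (1 - τ)) / b ^ 2))
    refine (measureReal_exists_le_abs_sum_centredIndicator_le hX hK h0 h1 hrate (t L) L
      (by positivity : 0 < b * w ^ L)).trans (le_of_eq ?_)
    rw [div_pow, mul_pow, ← pow_mul, ← pow_mul, mul_comm 2 L]
    field_simp
  have hne : ∑' L, μ (bad L) ≠ ⊤ := by
    have e : ∀ L, μ (bad L) = ENNReal.ofReal (μ.real (bad L)) := fun L =>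
      (ofReal_measureReal (measure_ne_top _ _)).symm
    simp only [e]
    exact hsum.tsum_ofReal_ne_top
  filter_upwards [ae_eventually_notMem hne] with ω hω
  filter_upwards [hω] with L hL m hm
  by_contra! hcon
  exact hL ⟨m, hm, hcon⟩

theorem measureReal_preimage_Iic_eq_cdf (hX : ∀ i, Measurable (X i))
    (hident : ∀ i, IdentDistrib (X i) (X 0) μ μ) (t : ℝ) (i : ℕ) :
    μ.real (X i ⁻¹' Set.Iic t) = cdf (μ.map (X 0)) t := by
  have : IsProbabilityMeasure (μ.map (X 0)) := Measure.isProbabilityMeasure_map (hX 0).aemeasurable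
  rw [cdf_eq_real, map_measureReal_apply (hX 0) measurableSet_Iic, measureReal_def,
    measureReal_def, (hident i).measure_mem_eq measurableSet_Iic]

theorem sum_centredIndicator_eq (hX : ∀ i, Measurable (X i))
    (hident : ∀ i, IdentDistrib (X i) (X 0) μ μ) {n : ℕ} (hn : 1 ≤ n) (t : ℝ) (ω : Ω) :
    ∑ i ∈ Finset.range n, centredIndicator μ X t i ω =
      n * (empiricalCDF X n ω t - cdf (μ.map (X 0)) t) := by
  have hn' : (n : ℝ) ≠ 0 := by positivity
  simp only [centredIndicator, measureReal_preimage_Iic_eq_cdf hX hident, empiricalCDF,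
    Finset.sum_sub_distrib]
  rw [mul_sub, ← mul_assoc, mul_one_div_cancel hn', one_mul]
  simp [Set.indicator]

end Mixing

theorem empiricalCDF_mono {Ω : Type*} (X : ℕ → Ω → ℝ) (n : ℕ) (ω : Ω) :
    Monotone (empiricalCDF X n ω) := by
  intro s t hst
  refine mul_le_mul_of_nonneg_left (Finset.sum_le_sum fun i _ => ?_) (by positivity)
  by_cases h : X i ω ≤ s
  · simp [h, h.trans hst]
  · simpa [Set.indicator, h] using ite_nonneg zero_le_one le_rfl

/-! ### From distribution functions to quantiles -/

theorem abs_leftInv_empiricalCDF_sub_le {Ω : Type*} (X : ℕ → Ω → ℝ) {n : ℕ} (hn : 1 ≤ n) (ω : Ω)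
    {y x δ : ℝ} (hy : y ∈ Set.Ioo 0 1) (hlow : empiricalCDF X n ω (x - δ) < y)
    (hup : y ≤ empiricalCDF X n ω (x + δ)) :
    |leftInv (empiricalCDF X n ω) y - x| ≤ δ := by
  have hglb := isGLB_leftInv_empiricalCDF X hn ω hy
  have h1 : leftInv (empiricalCDF X n ω) y ≤ x + δ := hglb.1 hup
  have h2 : x - δ ≤ leftInv (empiricalCDF X n ω) y := by
    refine hglb.2 fun t ht => ?_
    by_contra! hlt
    exact absurd (ht.trans (empiricalCDF_mono X n ω hlt.le)) (not_le.2 hlow)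
  rw [abs_le]
  constructor <;> linarith

theorem cdf_leftInv_eq {ν : Measure ℝ} [IsProbabilityMeasure ν] {y : ℝ} (hy : y ∈ Set.Ioo 0 1)
    (hc : ContinuousAt (cdf ν) (leftInv (cdf ν) y)) : cdf ν (leftInv (cdf ν) y) = y := by
  have hglb := isGLB_leftInv_cdf ν hy
  refine le_antisymm ?_ ?_
  · refine le_of_tendsto (hc.tendsto.mono_left (nhdsWithin_le_nhds (s := Set.Iio (leftInv (cdf ν) y)))) ?_
    filter_upwards [self_mem_nhdsWithin] with t ht
    by_contra! hlt
    exact absurd (hglb.1 (show t ∈ {t | y ≤ cdf ν t} from hlt.le)) (not_le.2 ht)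
  · refine ge_of_tendsto (hc.tendsto.mono_left (nhdsWithin_le_nhds (s := Set.Ioi (leftInv (cdf ν) y)))) ?_
    filter_upwards [self_mem_nhdsWithin] with t ht
    obtain ⟨s, hs, hst⟩ := (isGLB_lt_iff hglb).1 ht
    exact le_trans hs (monotone_cdf ν hst.le)

theorem exists_linear_growth {F : ℝ → ℝ} {x : ℝ} (hd : DifferentiableAt ℝ F x)
    (hpos : 0 < deriv F x) :
    ∃ c > 0, ∃ δ₀ > 0, ∀ δ, 0 < δ → δ < δ₀ →
      F x + c * δ ≤ F (x + δ) ∧ F (x - δ) ≤ F x - c * δ := by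
  have h := hd.hasDerivAt.isLittleO.def (half_pos hpos)
  obtain ⟨δ₀, hδ₀, hball⟩ := Metric.eventually_nhds_iff.1 h
  refine ⟨deriv F x / 2, half_pos hpos, δ₀, hδ₀, fun δ h0 h1 => ?_⟩
  have hp := hball (y := x + δ) (by simpa [abs_of_pos h0] using h1)
  have hm := hball (y := x - δ) (by simpa [Real.dist_eq, abs_of_pos h0] using h1)
  simp only [Real.norm_eq_abs, smul_eq_mul, add_sub_cancel_left, abs_of_pos h0,
    show x - δ - x = -δ by ring, abs_neg] at hp hm
  rw [abs_le] at hp hm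
  constructor <;> linarith [hp.1, hm.2]

/-- Within a dyadic block of sample sizes, the empirical distribution function is compared with the
true one at two points only, at distance `ε * 2 ^ (-r (l + 1))` from the quantile. -/
theorem ae_eventually_rpow_mul_le {Ω : Type*} [MeasurableSpace Ω] {μ : Measure Ω}
    [IsProbabilityMeasure μ] {X : ℕ → Ω → ℝ} (hX : ∀ i, Measurable (X i))
    (hident : ∀ i, IdentDistrib (X i) (X 0) μ μ) {K τ r : ℝ} (hK : 0 ≤ K) (h0 : 0 ≤ τ)
    (h1 : τ < 1) (hr0 : 0 ≤ r) (hr : 2 * r < τ)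
    (hrate : ∀ n : ℕ, 1 ≤ n → alphaCoeff μ X n ≤ K * (n : ℝ) ^ (-τ))
    {y : ℝ} (hy : y ∈ Set.Ioo 0 1) {x c δ₀ ε : ℝ} (hc : 0 < c) (hε : 0 < ε) (hε' : ε < δ₀)
    (hgrow : ∀ δ, 0 < δ → δ < δ₀ → y + c * δ ≤ cdf (μ.map (X 0)) (x + δ) ∧
      cdf (μ.map (X 0)) (x - δ) ≤ y - c * δ) :
    ∀ᵐ ω ∂μ, ∀ᶠ n : ℕ in atTop,
      (n : ℝ) ^ r * |leftInv (empiricalCDF X n ω) y - x| ≤ ε := by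
  set s : ℝ := (2 : ℝ) ^ (-r)
  have hs : 0 < s := by positivity
  have hs1 : s ≤ 1 := Real.rpow_le_one_of_one_le_of_nonpos one_le_two (by linarith)
  have hb : 0 < c * ε / 2 := by positivity
  filter_upwards [ae_eventually_abs_sum_centredIndicator_lt hX hK h0 h1 hr hrate
      (fun L => x + ε * s ^ L) hb,
    ae_eventually_abs_sum_centredIndicator_lt hX hK h0 h1 hr hrate
      (fun L => x - ε * s ^ L) hb] with ω hω₁ hω₂
  obtain ⟨L₀, hL₀⟩ := eventually_atTop.1 (hω₁.and hω₂)
  filter_upwards [eventually_ge_atTop (2 ^ L₀)] with n hn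
  have hn1 : 1 ≤ n := Nat.one_le_two_pow.trans hn
  -- `2 ^ l ≤ n < 2 ^ (l + 1)`: the deviation bound is used at scale `l + 1`, which costs the factor
  -- `2` in `c * ε / 2`.
  set l := Nat.log 2 n
  have hl : 2 ^ l ≤ n := Nat.pow_log_le_self 2 (by omega)
  have hl' : n < 2 ^ (l + 1) := Nat.lt_pow_succ_log_self one_lt_two n
  have hL : L₀ ≤ l := (Nat.le_log_iff_pow_le one_lt_two (by omega)).2 hn
  obtain ⟨hup, hlow⟩ := hL₀ (l + 1) (by omega)
  have hup := hup n hl'.le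
  have hlow := hlow n hl'.le
  rw [sum_centredIndicator_eq hX hident hn1] at hup hlow
  set δ := ε * s ^ (l + 1)
  have hδ : 0 < δ := by positivity
  have hδε : δ ≤ ε := mul_le_of_le_one_right hε.le (pow_le_one₀ hs.le hs1)
  have hnpos : (0 : ℝ) < n := by exact_mod_cast hn1
  have hbound : c * ε / 2 * (2 * s) ^ (l + 1) ≤ n * (c * δ) := by
    have hl2 : (2 : ℝ) ^ l ≤ n := by exact_mod_cast hl
    calc c * ε / 2 * (2 * s) ^ (l + 1) = 2 ^ l * (c * δ) := by
          simp only [δ, mul_pow, pow_succ (2 : ℝ) l]; ring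
      _ ≤ _ := by gcongr
  have hup := hup.trans_le hbound
  have hlow := hlow.trans_le hbound
  rw [abs_mul, abs_of_pos hnpos, mul_lt_mul_iff_right₀ hnpos, abs_lt] at hup hlow
  obtain ⟨hg1, hg2⟩ := hgrow δ hδ (hδε.trans_lt hε')
  have hq := abs_leftInv_empiricalCDF_sub_le X hn1 ω hy (x := x) (δ := δ)
    (by linarith [hlow.2]) (by linarith [hup.1])
  have hnr : (n : ℝ) ^ r * s ^ (l + 1) ≤ 1 := by
    have hle : (n : ℝ) ^ r ≤ ((2 : ℝ) ^ r) ^ (l + 1) := by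
      have : (n : ℝ) ≤ 2 ^ (l + 1) := by exact_mod_cast hl'.le
      calc (n : ℝ) ^ r ≤ ((2 : ℝ) ^ (l + 1)) ^ r := by gcongr
        _ = _ := by rw [← Real.rpow_natCast, ← Real.rpow_natCast, ← Real.rpow_mul zero_le_two,
          ← Real.rpow_mul zero_le_two, mul_comm]
    calc (n : ℝ) ^ r * s ^ (l + 1) ≤ ((2 : ℝ) ^ r) ^ (l + 1) * s ^ (l + 1) := by gcongr
      _ = 1 := by rw [← mul_pow, ← Real.rpow_add zero_lt_two, add_neg_cancel, Real.rpow_zero,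
        one_pow]
  calc (n : ℝ) ^ r * |leftInv (empiricalCDF X n ω) y - x| ≤ (n : ℝ) ^ r * δ := by gcongr
    _ = ε * ((n : ℝ) ^ r * s ^ (l + 1)) := by simp only [δ]; ring
    _ ≤ ε := mul_le_of_le_one_right hε.le hnr

end QuantileMixing

theorem theorem5 {Ω : Type*} [MeasurableSpace Ω] (μ : Measure Ω) [IsProbabilityMeasure μ]
    (X : ℕ → Ω → ℝ) (hX : ∀ i, Measurable (X i))
    (hident : ∀ i, IdentDistrib (X i) (X 0) μ μ)
    (F : ℝ → ℝ) (hF : F = cdf (μ.map (X 0)))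
    (hmix : QuantileMixing.IsAlphaMixing μ X)
    (r : ℝ) (hr : r ∈ Set.Ico (0 : ℝ) (1 / 2))
    (K ϑ : ℝ) (hK : 0 < K) (hϑ : 2 * r < ϑ)
    (hrate : ∀ n : ℕ, 1 ≤ n → QuantileMixing.alphaCoeff μ X n ≤ K * (n : ℝ) ^ (-ϑ))
    (y : ℝ) (hy : y ∈ Set.Ioo (0 : ℝ) 1)
    (hdiff : DifferentiableAt ℝ F (QuantileMixing.leftInv F y))
    (hderiv : 0 < deriv F (QuantileMixing.leftInv F y)) :
    ∀ᵐ ω ∂μ, Tendsto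
      (fun n : ℕ => (n : ℝ) ^ r *
        |QuantileMixing.leftInv (QuantileMixing.empiricalCDF X n ω) y
          - QuantileMixing.leftInv F y|)
      atTop (𝓝 0) := by
  subst hF
  have hprob : IsProbabilityMeasure (μ.map (X 0)) :=
    Measure.isProbabilityMeasure_map (hX 0).aemeasurable
  obtain ⟨τ, hτ₁, hτ₂⟩ := exists_between (lt_min hϑ (by linarith [hr.2] : 2 * r < 1))
  obtain ⟨hτϑ, hτ1⟩ := lt_min_iff.1 hτ₂
  have hτ0 : 0 ≤ τ := by linarith [hr.1]
  have hrate' : ∀ n : ℕ, 1 ≤ n → QuantileMixing.alphaCoeff μ X n ≤ K * (n : ℝ) ^ (-τ) :=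
    fun n hn => (hrate n hn).trans (mul_le_mul_of_nonneg_left
      (Real.rpow_le_rpow_of_exponent_le (by exact_mod_cast hn) (by linarith)) hK.le)
  obtain ⟨c, hc, δ₀, hδ₀, hgrow⟩ := QuantileMixing.exists_linear_growth hdiff hderiv
  rw [QuantileMixing.cdf_leftInv_eq hy hdiff.continuousAt] at hgrow
  -- It suffices to treat countably many radii, all below `δ₀`: for `r = 0` the radius of the
  -- bracketing interval does not shrink with `n`.
  obtain ⟨u, -, hu, hu0⟩ := exists_seq_strictAnti_tendsto' hδ₀
  have hall := ae_all_iff.2 fun k => QuantileMixing.ae_eventually_rpow_mul_le hX hident hK.le hτ0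
    hτ1 hr.1 hτ₁ hrate' hy hc (hu k).1 (hu k).2 hgrow
  filter_upwards [hall] with ω hω
  refine Metric.tendsto_nhds.2 fun ε hε => ?_
  obtain ⟨k, hk⟩ := (hu0.eventually (eventually_lt_nhds hε)).exists
  filter_upwards [hω k] with n hn
  rw [Real.dist_eq, sub_zero, abs_of_nonneg (by positivity)]
  exact hn.trans_lt hk
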